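/- Let $U=(U_n)_{n\ge 0}$ be a positional numeration system, i.e. a strictly increasing sequence of integers with $U_0=1$ and with $(U_{n+1}/U_n)_n$ bounded. For $x\in\mathbb N$ let $\mathrm{rep}_U(x)=a_{\ell-1}\cdots a_0$ be its greedy representation: $\ell$ is least with $x<U_\ell$, $r_\ell=x$, and $a_n=\lfloor r_{n+1}/U_n\rfloor$, $r_n=r_{n+1}-a_nU_n$ for $n=\ell-1,\ldots,0$. Assume that $U$ has an associated alternate base $B=(\beta_0,\ldots,\beta_{p-1})$ with $p\ge 1$ and all $\beta_i\ge 1$, i.e. $\lim_{n\to\infty}U_{np-i}/U_{np-i-1}=\beta_i$ for $0\le i<p$ (it is not required that $p$ be minimal); put $\beta_n=\beta_{n\bmod p}$ for all $n\ge 0$. For $0\le i<p$ let $\mathbf d_i=t_{i,0}t_{i,1}\cdots$ be the greedy expansion of $1$ in the base $(\beta_i,\beta_{i+1},\ldots)$: $r_0=1$, $t_{i,n}=\lfloor\beta_{i+n}r_n\rfloor$, $r_{n+1}=\beta_{i+n}r_n-t_{i,n}$. It is called finite if it ends in $0^\omega$; then $\ell_i$ denotes its length up to the last nonzero digit, $d'_i=t_{i,0}\cdots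 t_{i,\ell_i-2}(t_{i,\ell_i-1}-1)$, and $\sigma(i)=(i+\ell_i)\bmod p$ is the successor of $i$ in the graph $G$ on $\{0,\ldots,p-1\}$; if $\mathbf d_i$ is not finite, $i$ has no successor. The quasi-greedy expansion $\mathbf d_i^*$ is $\mathbf d_i$ if $\mathbf d_i$ is not finite and is given recursively by $\mathbf d^*_i=d'_i\,\mathbf d^*_{\sigma(i)}$ otherwise. Put $k_{i,j}=\sum_{h=0}^{j-1}\ell_{\sigma^h(i)}$ and define $m_{i,j}$ by $\sigma^j(i)=i+k_{i,j}-m_{i,j}p$, whenever the vertices and lengths involved exist. For large $n$ let $$(\Delta_i)_n=U_{np-i}-\sum_{\ell=1}^{\ell_i}t_{i,\ell-1}U_{np-i-\ell},\qquad (\Delta_i^{(j)})_n=\sum_{h=0}^{j-1}(\Delta_{\sigma^h(i)})_{n-m_{i,h}}.$$ For $c\ge 1$ let $L_i=\{\mathrm{rep}_U(U_{np-i}-1):n\ge 1\}$ and $L_{i,c}=\{\mathrm{rep}_{i,c}(n): n\ge 1,\ U_{np-i}\ge c\}$, where $\mathrm{rep}_{i,c}(n)$ is $\mathrm{rep}_U(U_{np-i}-c)$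 padded with leading zeros to length $np-i$. **Theorem.** Let $i\in\{0,\ldots,p-1\}$ and $r\ge 1$ be such that $\sigma^r(i)=i$ (all the successors involved exist, i.e. $\mathbf d_i,\ldots,\mathbf d_{\sigma^{r-1}(i)}$ are finite). Assume that the sequences $\Delta_i,\Delta_{\sigma(i)},\ldots,\Delta_{\sigma^{r-1}(i)}$ are all ultimately periodic with a common period $M\ge 1$ such that $Mp=M'k_{i,r}$ for an integer $M'\ge 1$. For $0\le j<r$ and $0\le e<M$ let $\Delta^{(M'r)}_{\sigma^j(i),e}$ be the ultimate constant value of $n\mapsto(\Delta^{(M'r)}_{\sigma^j(i)})_{nM+e}$. Then $\mathbf d_i^*=(d'_i d'_{\sigma(i)}\cdots d'_{\sigma^{r-1}(i)})^\omega$, and the following assertions are equivalent: (a) the languages $L_i,L_{\sigma(i)},\ldots,L_{\sigma^{r-1}(i)}$ are all regular; (b) for all $c\ge 1$, the languages $L_{i,c},L_{\sigma(i),c},\ldots,L_{\sigma^{r-1}(i),c}$ are all regular; (c) for all $e\in\{0,\ldots,\frac{k_{i,r}}p-1\}$ and $j\in\{0,\ldots,r-1\}$, $\Delta^{(M'r)}_{\sigma^j(i),e}\ge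 0$; (d) for all $e\in\{0,\ldots,\frac{k_{i,r}}p-1\}$, $\Delta^{(M'r)}_{i,e}\ge 0$. -/

import Mathlib

open Filter Topology

noncomputable section

/-- A positional numeration system: a (strictly) increasing sequence of integers `U`
with `U 0 = 1` and uniformly bounded quotients `U (n + 1) / U n`. -/
structure PositionalSystem where
  U : ℕ → ℕ
  strictMono : StrictMono U
  zero : U 0 = 1
  bounded : ∃ C : ℝ, ∀ n, (U (n + 1) : ℝ) / (U n : ℝ) ≤ C

namespace PositionalSystem

/-- The word `a_{ℓ-1} ⋯ a_0` of length `ℓ` produced by the greedy algorithm started from the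
remainder `x` at position `ℓ`. Words are lists, most significant digit first. -/
def greedyWord (S : PositionalSystem) : ℕ → ℕ → List ℕ
  | 0, _ => []
  | ℓ + 1, x => (x / S.U ℓ) :: S.greedyWord ℓ (x % S.U ℓ)

/-- The greedy representation `rep_U(x)`: the greedy algorithm is started at the least `ℓ`
with `x < U ℓ`. -/
def rep (S : PositionalSystem) (x : ℕ) : List ℕ :=
  S.greedyWord (sInf {ℓ | x < S.U ℓ}) x

/-- `rep_{i,c}(n)`: the word `rep_U(U_{np-i} - c)` padded with leading zeros to length `np - i`.
Used for `i < p`, `1 ≤ n` and `1 ≤ c ≤ U_{np-i}`. -/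
def repPad (S : PositionalSystem) (p i c n : ℕ) : List ℕ :=
  List.replicate (n * p - i - (S.rep (S.U (n * p - i) - c)).length) 0
    ++ S.rep (S.U (n * p - i) - c)

/-- The language `L_i = {rep_U(U_{np-i} - 1) : n ≥ 1}`. The digits that occur are bounded, so that
regularity as a language over `ℕ` is the same as regularity over the finite numeration alphabet. -/
def lang (S : PositionalSystem) (p i : ℕ) : Language ℕ :=
  {w | ∃ n, 1 ≤ n ∧ w = S.rep (S.U (n * p - i) - 1)}

/-- The language `L_{i,c} = {rep_{i,c}(n) : n ≥ 1, U_{np-i} ≥ c}`. -/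
def langC (S : PositionalSystem) (p i c : ℕ) : Language ℕ :=
  {w | ∃ n, 1 ≤ n ∧ c ≤ S.U (n * p - i) ∧ w = S.repPad p i c n}

end PositionalSystem

/-- An alternate real base `(β_0, …, β_{p-1})`, a nonempty tuple of real numbers `≥ 1`. -/
structure AlternateBase where
  p : ℕ
  p_pos : 0 < p
  base : Fin p → ℝ
  one_le : ∀ i, 1 ≤ base i

namespace AlternateBase

/-- The periodic extension `β_n = β_{n mod p}`. -/
def beta (B : AlternateBase) (n : ℕ) : ℝ :=
  B.base ⟨n % B.p, Nat.mod_lt n B.p_pos⟩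

/-- The remainders `r_n` of the greedy algorithm for `x` in the shifted base
`B^{(i)} = (β_i, …, β_{i+p-1})`. -/
def remainder (B : AlternateBase) (i : ℕ) (x : ℝ) : ℕ → ℝ
  | 0 => x
  | n + 1 => B.beta (i + n) * B.remainder i x n
      - (⌊B.beta (i + n) * B.remainder i x n⌋₊ : ℝ)

/-- The digit `t_{i,n}` of the greedy expansion `𝐝_i` of `1` in the base `B^{(i)}`. -/
def t (B : AlternateBase) (i n : ℕ) : ℕ :=
  ⌊B.beta (i + n) * B.remainder i 1 n⌋₊

/-- `𝐝_i` is finite: it ends in a tail of zeros. -/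
def IsFin (B : AlternateBase) (i : ℕ) : Prop :=
  ∃ N, ∀ n, N ≤ n → B.t i n = 0

/-- The length `ℓ_i` of `𝐝_i`, up to the last nonzero digit (meaningful if `𝐝_i` is finite). -/
def len (B : AlternateBase) (i : ℕ) : ℕ :=
  sInf {N | ∀ n, N ≤ n → B.t i n = 0}

/-- The successor `σ(i) = (i + ℓ_i) mod p` of the vertex `i` in the graph `G`. The vertex `i` has
a successor only if `𝐝_i` is finite; for other `i` the value is not used. -/
def sigma (B : AlternateBase) (i : ℕ) : ℕ :=
  (i + B.len i) % B.p

/-- The vertex `i` satisfies `σ^r(i) = i` with `r ≥ 1`, where all the successors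
`σ(i), …, σ^r(i)` exist in the graph `G`. -/
structure IsCycle (B : AlternateBase) (i r : ℕ) : Prop where
  vertex : i < B.p
  pos : 1 ≤ r
  fin : ∀ h < r, B.IsFin (B.sigma^[h] i)
  closed : B.sigma^[r] i = i

/-- `k_{i,j} = ℓ_i + ℓ_{σ(i)} + ⋯ + ℓ_{σ^{j-1}(i)}`. -/
def k (B : AlternateBase) (i j : ℕ) : ℕ :=
  ∑ h ∈ Finset.range j, B.len (B.sigma^[h] i)

/-- The integer `m_{i,j}` with `σ^j(i) = i + k_{i,j} - m_{i,j} p`. -/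
def m (B : AlternateBase) (i j : ℕ) : ℕ :=
  (i + B.k i j - B.sigma^[j] i) / B.p

/-- The finite word `d'_i = t_{i,0} ⋯ t_{i,ℓ_i-2} (t_{i,ℓ_i-1} - 1)`. -/
def dPrime (B : AlternateBase) (i : ℕ) : List ℕ :=
  (List.range (B.len i)).map fun n => if n + 1 = B.len i then B.t i n - 1 else B.t i n

theorem t_zero_pos (B : AlternateBase) (i : ℕ) : 0 < B.t i 0 := by
  have h : 1 ≤ B.beta (i + 0) := B.one_le _
  simpa [t, remainder, Nat.floor_pos] using h

theorem len_pos {B : AlternateBase} {i : ℕ} (h : B.IsFin i) : 0 < B.len i := by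
  have hmem : B.len i ∈ {N | ∀ n, N ≤ n → B.t i n = 0} := Nat.sInf_mem h
  rcases Nat.eq_zero_or_pos (B.len i) with h0 | h0
  · have h1 := hmem 0 (by omega)
    have h2 := B.t_zero_pos i
    omega
  · exact h0

/-- The defining equation of `m_{i,j}`. -/
theorem m_spec (B : AlternateBase) {i : ℕ} (hi : i < B.p) (j : ℕ) :
    B.sigma^[j] i + B.m i j * B.p = i + B.k i j := by
  have key : B.sigma^[j] i = (i + B.k i j) % B.p := by
    induction j with
    | zero => simp [k, Nat.mod_eq_of_lt hi]
    | succ j ih =>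
      have hk : B.k i (j + 1) = B.k i j + B.len (B.sigma^[j] i) := by
        simp only [k, Finset.sum_range_succ]
      rw [Function.iterate_succ_apply', sigma, hk]
      generalize B.len (B.sigma^[j] i) = L
      rw [ih, Nat.mod_add_mod, add_assoc]
  have h1 : B.p ∣ i + B.k i j - B.sigma^[j] i := by
    rw [key]; exact Nat.dvd_sub_mod _
  have h2 : B.sigma^[j] i ≤ i + B.k i j := by
    rw [key]; exact Nat.mod_le _ _
  rw [m, Nat.div_mul_cancel h1]
  omega

open Classical in
/-- The quasi-greedy expansion `𝐝*_i` of `1` in the base `B^{(i)}`: it is `𝐝_i` if `𝐝_i` is infinite,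
and `d'_i 𝐝*_{σ(i)}` if `𝐝_i` is finite. -/
def quasiGreedy (B : AlternateBase) (i n : ℕ) : ℕ :=
  if _h : B.IsFin i then
    if _hn : n < B.len i then (B.dPrime i).getD n 0
    else B.quasiGreedy (B.sigma i) (n - B.len i)
  else B.t i n
termination_by n
decreasing_by
  have := len_pos _h
  omega

/-- The finite word `d'_i d'_{σ(i)} ⋯ d'_{σ^{r-1}(i)}`. -/
def cycleWord (B : AlternateBase) (i r : ℕ) : List ℕ :=
  ((List.range r).map fun h => B.dPrime (B.sigma^[h] i)).flatten

end AlternateBase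

/-- The infinite word `w^ω` (for a nonempty word `w`). -/
def omegaPower (w : List ℕ) (n : ℕ) : ℕ :=
  w.getD (n % w.length) 0

/-- `u` is ultimately periodic and `M ≥ 1` is a period of it (not necessarily the least one). -/
def UltimatelyPeriodic (u : ℕ → ℤ) (M : ℕ) : Prop :=
  1 ≤ M ∧ ∃ N, ∀ n, N ≤ n → u (n + M) = u n

open Classical in
/-- The ultimate constant value of an ultimately constant sequence (and `0` otherwise). -/
def ultimateValue (u : ℕ → ℤ) : ℤ :=
  if h : ∃ v, ∀ᶠ n in atTop, u n = v then h.choose else 0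

theorem ultimateValue_eq {u : ℕ → ℤ} {v : ℤ} (h : ∀ᶠ n in atTop, u n = v) :
    ultimateValue u = v := by
  have hex : ∃ v, ∀ᶠ n in atTop, u n = v := ⟨v, h⟩
  rw [ultimateValue, dif_pos hex]
  obtain ⟨n, h1, h2⟩ := (hex.choose_spec.and h).exists
  exact h1.symm.trans h2

namespace PositionalSystem

/-- `B = (β_0, …, β_{p-1})` is an alternate real base associated with `U`:
`β_i = lim U_{np-i} / U_{np-i-1}` for all `i < p`. -/
def HasAssociatedBase (S : PositionalSystem) (B : AlternateBase) : Prop :=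
  ∀ i < B.p, Tendsto (fun n : ℕ => (S.U (n * B.p - i) : ℝ) / (S.U (n * B.p - i - 1) : ℝ))
    atTop (𝓝 (B.beta i))

/-- `(Δ_i)_n = U_{np-i} - ∑_{ℓ=1}^{ℓ_i} t_{i,ℓ-1} U_{np-i-ℓ}`, meaningful when `𝐝_i` is finite and
`np - i ≥ ℓ_i`; only the values for large `n` matter. -/
def Delta (S : PositionalSystem) (B : AlternateBase) (i n : ℕ) : ℤ :=
  (S.U (n * B.p - i) : ℤ)
    - ∑ l ∈ Finset.Icc 1 (B.len i), (B.t i (l - 1) : ℤ) * (S.U (n * B.p - i - l) : ℤ)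

/-- `(Δ_i^{(j)})_n = ∑_{h=0}^{j-1} (Δ_{σ^h(i)})_{n - m_{i,h}}`, meaningful when `np - i ≥ k_{i,j}`. -/
def DeltaSum (S : PositionalSystem) (B : AlternateBase) (i j n : ℕ) : ℤ :=
  ∑ h ∈ Finset.range j, S.Delta B (B.sigma^[h] i) (n - B.m i h)

/-- The constant `Δ^{(j)}_{i,e}`: the ultimate constant value of `n ↦ (Δ_i^{(j)})_{nM+e}`. -/
def DeltaConst (S : PositionalSystem) (B : AlternateBase) (M i j e : ℕ) : ℤ :=
  ultimateValue fun n => S.DeltaSum B i j (n * M + e)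

end PositionalSystem

end

/-! Run the greedy algorithm on `U_{np-i} - c` for large `n`. After `l` steps of subtracting the
digits of `𝐝_i`, the remainder divided by `U_{np-i-l}` tends to the `l`-th remainder of `1`, which
lies strictly between 0 and 1 for `0 < l < ℓ_i`. So these digits are the true ones, and only the
last is affected by the exact value `d` of `Δ_i`. If `d < c`, a borrow produces `d'_i`, followed by
the word of `U_{n'p-σ(i)} - (c - d)`; if `c ≤ d`, the word is `𝐝_i` followed by the padded word of
the constant `d - c` (`padWord_eq`).

On a residue class of `n` mod `M`, iterating replaces `c` by `c - δ h`, where `δ h` is the constant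
partial sum of the `Δ`'s. One turn of `R = M'r` steps lowers `n` by exactly `M` and `c` by `δ R`. If
`δ R = 0`, one cycle word is pumped; if `δ R > 0`, `c` decreases until the algorithm leaves the
cycle; both give regular languages (`isRegular_range_padWord`). If `δ R < 0`, starting at a vertex
where the partial sums are maximal keeps every borrow in force, so `c` grows by `-δ R` per turn and
the tail determines the number of turns, which no finite automaton can check (`not_isRegular_lang`).

The total over a full turn is invariant under moving along the cycle (`DeltaSum_shift`). This
reduces the sign condition to the single vertex `i` and to residues below `k_{i,r} / p`. -/

namespace Language

/-! ### Regularity of languages via left quotients. -/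

variable {α : Type*}

/-- Myhill–Nerode: reading a word letter by letter never leaves `F`, so there are finitely many left
quotients. -/
theorem isRegular_of_leftQuotient_mem {L : Language α} (F : Set (Language α)) (hF : F.Finite)
    (hL : L ∈ F) (hstep : ∀ K ∈ F, ∀ a, K.leftQuotient [a] ∈ F) : L.IsRegular := by
  refine IsRegular.of_finite_range_leftQuotient (hF.subset ?_)
  rintro _ ⟨y, rfl⟩
  induction y using List.reverseRecOn with
  | nil => simpa using hL
  | append_singleton y a ih => rw [leftQuotient_append]; exact hstep _ ih a

theorem isRegular_empty : IsRegular ((∅ : Set (List α)) : Language α) := by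
  refine isRegular_of_leftQuotient_mem {(∅ : Set (List α))} (Set.finite_singleton _) rfl ?_
  rintro _ rfl a
  exact rfl

theorem isRegular_singleton (v : List α) : IsRegular (({v} : Set (List α)) : Language α) := by
  refine isRegular_of_leftQuotient_mem
    (insert (∅ : Set (List α)) ((fun s : List α => ({s} : Set (List α))) '' {s | s <:+ v}))
    (((List.finite_toSet v.tails).subset fun s hs => by simpa using hs).image _ |>.insert _)
    (Or.inr ⟨v, List.suffix_refl v, rfl⟩) ?_
  rintro _ (rfl | ⟨s, hs, rfl⟩) a
  · exact Or.inl rfl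
  · rcases s with _ | ⟨b, s⟩
    · left
      ext z
      change a :: z ∈ ({[]} : Set (List α)) ↔ False
      simp
    · by_cases hab : a = b
      · right
        refine ⟨s, (List.suffix_cons b s).trans hs, ?_⟩
        ext z
        change z ∈ ({s} : Set (List α)) ↔ a :: z ∈ ({b :: s} : Set (List α))
        simp [hab]
      · left
        ext z
        change a :: z ∈ ({b :: s} : Set (List α)) ↔ False
        simp [hab]

theorem isRegular_of_finite {L : Language α} (h : Set.Finite (L : Set (List α))) :
    L.IsRegular := by
  refine Set.Finite.induction_on (motive := fun s _ => IsRegular (s : Language α)) _ h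
    isRegular_empty ?_
  intro v s _ _ ih
  exact (isRegular_singleton v).add ih

theorem IsRegular.of_finite_sdiff {L K : Language α} (hL : L.IsRegular)
    (h1 : Set.Finite {w | w ∈ L ∧ w ∉ K}) (h2 : Set.Finite {w | w ∈ K ∧ w ∉ L}) :
    K.IsRegular := by
  have h := (hL.inf (isRegular_of_finite (L := {w | w ∈ L ∧ w ∉ K}) h1).compl).add
    (isRegular_of_finite (L := {w | w ∈ K ∧ w ∉ L}) h2)
  convert h using 1
  ext w
  change w ∈ K ↔ (w ∈ L ∧ ¬ (w ∈ L ∧ w ∉ K)) ∨ (w ∈ K ∧ w ∉ L)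
  tauto

theorem IsRegular.append_left {L : Language α} (hL : L.IsRegular) (u : List α) :
    IsRegular (({w | ∃ z ∈ L, w = u ++ z} : Set (List α)) : Language α) := by
  induction u with
  | nil =>
    simp only [List.nil_append, exists_eq_right']
    exact hL
  | cons b u ih =>
    refine IsRegular.of_finite_range_leftQuotient
      (((ih.finite_range_leftQuotient.insert (∅ : Set (List α))).insert
        ({w | ∃ z ∈ L, w = (b :: u) ++ z} : Set (List α))).subset ?_)
    rintro _ ⟨y, rfl⟩
    rcases y with _ | ⟨a, y⟩
    · exact Or.inl (leftQuotient_nil _)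
    · right
      by_cases hab : a = b
      · right
        refine ⟨y, ?_⟩
        ext z
        change (∃ t ∈ L, y ++ z = u ++ t) ↔ ∃ t ∈ L, a :: y ++ z = b :: u ++ t
        simp [hab]
      · left
        ext z
        change (∃ t ∈ L, a :: y ++ z = b :: u ++ t) ↔ False
        simp [hab]

theorem isRegular_replicate_append (x v : List α) :
    IsRegular (({w | ∃ n, w = (List.replicate n x).flatten ++ v} : Set (List α)) :
      Language α) := by
  rcases x with _ | ⟨b, x⟩
  · refine isRegular_of_finite ((Set.finite_singleton v).subset ?_)
    rintro w ⟨n, rfl⟩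
    simp
  set L : Set (List α) := {w | ∃ n, w = (List.replicate n (b :: x)).flatten ++ v} with hLdef
  have hL : ∀ z, z ∈ L ↔ z = v ∨ ∃ y ∈ L, z = b :: x ++ y := by
    intro z
    constructor
    · rintro ⟨n, rfl⟩
      cases n with
      | zero => left; simp
      | succ n => exact Or.inr ⟨_, ⟨n, rfl⟩, by simp [List.replicate_succ]⟩
    · rintro (rfl | ⟨_, ⟨n, rfl⟩, rfl⟩)
      · exact ⟨0, by simp⟩
      · exact ⟨n + 1, by simp [List.replicate_succ]⟩
  -- Every quotient of `L` has the form `A ∪ sL` or just `A`, with `A` a set of suffixes of `v` and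
  -- `s` a suffix of `b :: x`; there are finitely many such pairs.
  let G : Set (List α) → Option (List α) → Language α := fun A o =>
    ({z | z ∈ A ∨ ∃ s, o = some s ∧ ∃ y ∈ L, z = s ++ y} : Set (List α))
  have hsuf : ∀ u : List α, {s | s <:+ u}.Finite := fun u =>
    (List.finite_toSet u.tails).subset fun s hs => by simpa using hs
  let P : Set (Set (List α)) := 𝒫 {s | s <:+ v}
  let Q : Set (Option (List α)) := insert none (some '' {s | s <:+ b :: x})
  have hA : ∀ A ∈ P, ∀ a, {z | a :: z ∈ A} ∈ P := fun A hA a z hz =>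
    (List.suffix_cons a z).trans (hA hz)
  have hmem : ∀ A o a z, z ∈ (G A o).leftQuotient [a] ↔
      a :: z ∈ A ∨ ∃ s, o = some s ∧ ∃ y ∈ L, a :: z = s ++ y := fun _ _ _ _ => Iff.rfl
  have hmem' : ∀ A o z, z ∈ G A o ↔ z ∈ A ∨ ∃ s, o = some s ∧ ∃ y ∈ L, z = s ++ y :=
    fun _ _ _ => Iff.rfl
  refine isRegular_of_leftQuotient_mem (Set.image2 G P Q)
    ((hsuf v).powerset.image2 _ (((hsuf _).image _).insert _)) ?_ ?_
  · refine ⟨∅, Set.empty_subset _, some [], Or.inr ⟨[], List.nil_suffix, rfl⟩, ?_⟩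
    ext z
    rw [hmem']
    simp only [Set.mem_empty_iff_false, false_or, Option.some.injEq, exists_eq_left',
      List.nil_append, exists_eq_right']
    rfl
  · have cons_case : ∀ A ∈ P, ∀ c s, (c :: s) <:+ b :: x → ∀ a,
        (G A (some (c :: s))).leftQuotient [a] ∈ Set.image2 G P Q := by
      intro A hAP c s hs a
      by_cases hac : a = c
      · refine ⟨_, hA A hAP a, some s, Or.inr ⟨s, (List.suffix_cons c s).trans hs, rfl⟩, ?_⟩
        ext z
        rw [hmem, hmem']
        simp [hac]
      · refine ⟨_, hA A hAP a, none, Or.inl rfl, ?_⟩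
        ext z
        rw [hmem, hmem']
        simp [hac]
    rintro _ ⟨A, hAP, o, (rfl | ⟨s, hs, rfl⟩), rfl⟩ a
    · refine ⟨_, hA A hAP a, none, Or.inl rfl, ?_⟩
      ext z
      rw [hmem, hmem']
      simp
    · rcases s with _ | ⟨c, s⟩
      -- When the pending block is used up, unfold `L = {v} ∪ (b :: x)L` so that the next letter has
      -- something to match.
      · have : G A (some []) = G (insert v A) (some (b :: x)) := by
          ext z
          rw [hmem', hmem']
          simp only [Option.some.injEq, exists_eq_left', List.nil_append, exists_eq_right',
            Set.mem_insert_iff]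
          rw [hL z]
          tauto
        rw [this]
        exact cons_case _ (Set.insert_subset (List.suffix_refl v) hAP) b x (List.suffix_refl _) a
      · exact cons_case A hAP c s hs a

theorem isRegular_range_of_eventually_append {f : ℕ → List α} (x : List α)
    (h : ∀ᶠ n in atTop, f (n + 1) = x ++ f n) :
    IsRegular ((Set.range f : Set (List α)) : Language α) := by
  obtain ⟨N, hN⟩ := eventually_atTop.1 h
  have hf : ∀ n, f (N + n) = (List.replicate n x).flatten ++ f N := by
    intro n
    induction n with
    | zero => simp
    | succ n ih =>
      rw [← add_assoc, hN _ (by omega), ih, List.replicate_succ, List.flatten_cons,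
        List.append_assoc]
  refine (isRegular_replicate_append x (f N)).of_finite_sdiff
    (Set.finite_empty.subset ?_) (((Set.finite_lt_nat N).image f).subset ?_)
  · rintro _ ⟨⟨n, rfl⟩, h2⟩
    exact h2 ⟨N + n, hf n⟩
  · rintro _ ⟨⟨n, rfl⟩, h2⟩
    refine ⟨n, ?_, rfl⟩
    by_contra hn
    obtain ⟨k, rfl⟩ := Nat.exists_eq_add_of_le (not_lt.1 hn)
    exact h2 ⟨k, hf k⟩

theorem isRegular_range_of_eventually_eq_append {f g : ℕ → List α} (x : List α)
    (hg : IsRegular ((Set.range g : Set (List α)) : Language α))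
    (h : ∀ᶠ n in atTop, f (n + 1) = x ++ g n) :
    IsRegular ((Set.range f : Set (List α)) : Language α) := by
  obtain ⟨N, hN⟩ := eventually_atTop.1 h
  refine (hg.append_left x).of_finite_sdiff
    (((Set.finite_lt_nat N).image fun n => x ++ g n).subset ?_)
    (((Set.finite_lt_nat (N + 1)).image f).subset ?_)
  · rintro _ ⟨⟨_, ⟨n, rfl⟩, rfl⟩, h2⟩
    refine ⟨n, ?_, rfl⟩
    by_contra hn
    exact h2 ⟨n + 1, hN n (not_lt.1 hn)⟩
  · rintro _ ⟨⟨n, rfl⟩, h2⟩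
    refine ⟨n, ?_, rfl⟩
    by_contra hn
    rw [Set.mem_ofPred_eq, not_lt] at hn
    obtain ⟨k, rfl⟩ := Nat.exists_eq_add_of_le' (show 1 ≤ n by omega)
    exact h2 ⟨g k, ⟨k, rfl⟩, hN k (by omega)⟩

theorem isRegular_range_of_residues {f : ℕ → List α} {M : ℕ} (hM : 0 < M)
    (h : ∀ e < M, IsRegular ((Set.range fun q => f (q * M + e) : Set (List α)) : Language α)) :
    IsRegular ((Set.range f : Set (List α)) : Language α) := by
  have key : ∀ m ≤ M, IsRegular
      (({w | ∃ e < m, w ∈ Set.range fun q => f (q * M + e)} : Set (List α)) : Language α) := by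
    intro m
    induction m with
    | zero => intro _; simpa using isRegular_empty
    | succ m ih =>
      intro hm
      refine Eq.mpr (congrArg IsRegular ?_) ((ih (by omega)).add (h m hm))
      ext w
      change (∃ e < m + 1, w ∈ Set.range fun q => f (q * M + e)) ↔
        (∃ e < m, w ∈ Set.range fun q => f (q * M + e)) ∨ w ∈ Set.range fun q => f (q * M + m)
      simp only [Nat.lt_succ_iff_lt_or_eq, or_and_right, exists_or, exists_eq_left]
  refine Eq.mpr (congrArg IsRegular ?_) (key M le_rfl)
  ext w
  change (∃ n, f n = w) ↔ ∃ e < M, ∃ q, f (q * M + e) = w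
  constructor
  · rintro ⟨n, rfl⟩
    exact ⟨n % M, Nat.mod_lt n hM, n / M, by rw [Nat.div_add_mod']⟩
  · rintro ⟨e, _, q, rfl⟩
    exact ⟨_, rfl⟩

theorem IsRegular.of_eventually {f : ℕ → List α}
    (hf : IsRegular ((Set.range f : Set (List α)) : Language α)) {P : ℕ → Prop} {g : ℕ → List α}
    (h : ∀ᶠ n in atTop, P n ∧ g n = f n) :
    IsRegular (({w | ∃ n, P n ∧ w = g n} : Set (List α)) : Language α) := by
  obtain ⟨N, hN⟩ := eventually_atTop.1 h
  refine hf.of_finite_sdiff (((Set.finite_lt_nat N).image f).subset ?_)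
    (((Set.finite_lt_nat N).image g).subset ?_)
  · rintro _ ⟨⟨n, rfl⟩, h2⟩
    refine ⟨n, ?_, rfl⟩
    by_contra hn
    exact h2 ⟨n, (hN n (not_lt.1 hn)).1, (hN n (not_lt.1 hn)).2.symm⟩
  · rintro _ ⟨⟨n, _, rfl⟩, h2⟩
    refine ⟨n, ?_, rfl⟩
    by_contra hn
    exact h2 ⟨n, (hN n (not_lt.1 hn)).2.symm⟩

end Language

/-! ### Greedy words in the system `U`. -/

namespace PositionalSystem

variable (S : PositionalSystem)

theorem U_pos (n : ℕ) : 0 < S.U n :=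
  lt_of_lt_of_le (by rw [S.zero]; exact one_pos) (S.strictMono.monotone (Nat.zero_le n))

theorem length_greedyWord (ℓ x : ℕ) : (S.greedyWord ℓ x).length = ℓ := by
  induction ℓ generalizing x with
  | zero => rfl
  | succ ℓ ih => simp [greedyWord, ih]

theorem greedyWord_injOn (ℓ : ℕ) {x y : ℕ} (hx : x < S.U ℓ) (hy : y < S.U ℓ)
    (h : S.greedyWord ℓ x = S.greedyWord ℓ y) : x = y := by
  induction ℓ generalizing x y with
  | zero => rw [S.zero] at hx hy; omega
  | succ ℓ ih =>
    simp only [greedyWord, List.cons.injEq] at h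
    have h2 := ih (Nat.mod_lt _ (S.U_pos ℓ)) (Nat.mod_lt _ (S.U_pos ℓ)) h.2
    rw [← Nat.div_add_mod x (S.U ℓ), ← Nat.div_add_mod y (S.U ℓ), h.1, h2]

theorem greedyWord_add {b x : ℕ} (hx : x < S.U b) (a : ℕ) :
    S.greedyWord (a + b) x = List.replicate a 0 ++ S.greedyWord b x := by
  induction a with
  | zero => simp
  | succ a ih =>
    have h : x < S.U (a + b) := hx.trans_le (S.strictMono.monotone (Nat.le_add_left b a))
    rw [Nat.add_right_comm, greedyWord, Nat.div_eq_of_lt h, Nat.mod_eq_of_lt h, ih,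
      List.replicate_succ, List.cons_append]

/-- Uniqueness of Euclidean division: a chain of remainders within the right bounds certifies the
digits. -/
theorem greedyWord_eq_append (t R : ℕ → ℕ) (N m : ℕ) (hm : m ≤ N)
    (h : ∀ l < m, R l = t l * S.U (N - l - 1) + R (l + 1) ∧ R (l + 1) < S.U (N - l - 1)) :
    S.greedyWord N (R 0) = (List.range m).map t ++ S.greedyWord (N - m) (R m) := by
  induction m with
  | zero => simp
  | succ m ih =>
    rw [ih (by omega) fun l hl => h l (by omega), List.range_succ, List.map_append,
      List.append_assoc]
    obtain ⟨h1, h2⟩ := h m (by omega)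
    have h3 : N - m = (N - m - 1) + 1 := by omega
    rw [h3, greedyWord, h1, mul_comm, Nat.mul_add_div (S.U_pos _), Nat.div_eq_of_lt h2,
      Nat.mul_add_mod, Nat.mod_eq_of_lt h2]
    simp [Nat.sub_sub]

/-- Starting the greedy algorithm at a higher position only adds leading zeros. -/
theorem repPad_eq_greedyWord (p i c n : ℕ) (hc : 1 ≤ c) :
    S.repPad p i c n = S.greedyWord (n * p - i) (S.U (n * p - i) - c) := by
  rw [repPad, rep]
  generalize n * p - i = N
  have hN := S.U_pos N
  have hmem : N ∈ {ℓ | S.U N - c < S.U ℓ} := by change S.U N - c < S.U N; omega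
  have h1 : sInf {ℓ | S.U N - c < S.U ℓ} ≤ N := Nat.sInf_le hmem
  have h2 : S.U N - c < S.U (sInf {ℓ | S.U N - c < S.U ℓ}) := Nat.sInf_mem ⟨N, hmem⟩
  rw [length_greedyWord, ← S.greedyWord_add h2, Nat.sub_add_cancel h1]

theorem rep_U_sub_one (N : ℕ) : S.rep (S.U N - 1) = S.greedyWord N (S.U N - 1) := by
  have hN := S.U_pos N
  have hmem : N ∈ {ℓ | S.U N - 1 < S.U ℓ} := by change S.U N - 1 < S.U N; omega
  have h1 : sInf {ℓ | S.U N - 1 < S.U ℓ} ≤ N := Nat.sInf_le hmem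
  have h2 : S.U N - 1 < S.U (sInf {ℓ | S.U N - 1 < S.U ℓ}) := Nat.sInf_mem ⟨N, hmem⟩
  have h3 : N ≤ sInf {ℓ | S.U N - 1 < S.U ℓ} := S.strictMono.le_iff_le.1 (by omega)
  rw [rep, le_antisymm h1 h3]

theorem langC_one (p i : ℕ) : S.langC p i 1 = S.lang p i := by
  ext w
  change (∃ n, 1 ≤ n ∧ 1 ≤ S.U (n * p - i) ∧ w = S.repPad p i 1 n) ↔
    ∃ n, 1 ≤ n ∧ w = S.rep (S.U (n * p - i) - 1)
  simp only [S.repPad_eq_greedyWord p i 1 _ le_rfl, rep_U_sub_one]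
  exact exists_congr fun n => and_congr_right fun _ => and_iff_right (S.U_pos _)

/-- The greedy word of length `np - i` of the number `U_{np-i} - c`, for an integer `c`. -/
def padWord (p i : ℕ) (c : ℤ) (n : ℕ) : List ℕ :=
  S.greedyWord (n * p - i) ((S.U (n * p - i) : ℤ) - c).toNat

theorem tendsto_mul_sub_atTop {p : ℕ} (hp : 0 < p) (a : ℕ) :
    Tendsto (fun n : ℕ => n * p - a) atTop atTop :=
  (tendsto_sub_atTop_nat a).comp (tendsto_id.atTop_mul_const' hp)

theorem tendsto_U : Tendsto (fun n => (S.U n : ℝ)) atTop atTop :=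
  tendsto_natCast_atTop_atTop.comp S.strictMono.tendsto_atTop

theorem HasAssociatedBase.tendsto {S : PositionalSystem} {B : AlternateBase}
    (hB : S.HasAssociatedBase B) (a : ℕ) :
    Tendsto (fun n : ℕ => (S.U (n * B.p - a) : ℝ) / (S.U (n * B.p - a - 1) : ℝ))
      atTop (𝓝 (B.beta a)) := by
  -- An index `a ≥ p` is reduced mod `p` by moving `n` back by `a / p`.
  have h := (hB (a % B.p) (Nat.mod_lt _ B.p_pos)).comp (tendsto_sub_atTop_nat (a / B.p))
  have h1 : B.beta (a % B.p) = B.beta a := by simp [AlternateBase.beta]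
  rw [h1] at h
  refine h.congr fun n => ?_
  have h2 : (n - a / B.p) * B.p - a % B.p = n * B.p - a := by
    rw [Nat.sub_mul, Nat.sub_sub, Nat.div_add_mod']
  simp only [Function.comp_apply, h2]

end PositionalSystem

/-! ### Remainders and last digits of the expansions of 1. -/

namespace AlternateBase

variable (B : AlternateBase)

theorem beta_nonneg (n : ℕ) : 0 ≤ B.beta n := zero_le_one.trans (B.one_le _)

theorem remainder_succ (i n : ℕ) :
    B.remainder i 1 (n + 1) = B.beta (i + n) * B.remainder i 1 n - B.t i n := rfl

theorem remainder_nonneg (i n : ℕ) : 0 ≤ B.remainder i 1 n := by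
  induction n with
  | zero => exact zero_le_one
  | succ n ih =>
    rw [remainder_succ, sub_nonneg]
    exact Nat.floor_le (mul_nonneg (B.beta_nonneg _) ih)

theorem remainder_succ_lt_one (i n : ℕ) : B.remainder i 1 (n + 1) < 1 := by
  rw [remainder_succ, sub_lt_iff_lt_add']
  exact Nat.lt_floor_add_one _

theorem remainder_pos {i l : ℕ} (hl : l < B.len i) : 0 < B.remainder i 1 l := by
  refine (B.remainder_nonneg i l).lt_of_ne fun h0 => ?_
  have hz : ∀ a, B.remainder i 1 (l + a) = 0 ∧ B.t i (l + a) = 0 := by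
    intro a
    induction a with
    | zero => simp [t, ← h0]
    | succ a ih =>
      have h1 : B.remainder i 1 (l + (a + 1)) = 0 := by
        rw [← add_assoc, remainder_succ, ih.1, ih.2]; simp
      exact ⟨h1, by simp [t, h1]⟩
  have : B.len i ≤ l := Nat.sInf_le fun n hn => by
    obtain ⟨a, rfl⟩ := Nat.exists_eq_add_of_le hn
    exact (hz a).2
  omega

theorem t_last_pos {i l : ℕ} (hl : l + 1 = B.len i) : 0 < B.t i l := by
  refine Nat.pos_of_ne_zero fun h0 => ?_
  have hfin : B.IsFin i := by
    by_contra h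
    have : B.len i = 0 := by
      rw [len, Nat.sInf_eq_zero]
      exact Or.inr (Set.eq_empty_of_forall_notMem fun N hN => h ⟨N, hN⟩)
    omega
  have hmem : B.len i ∈ {N | ∀ n, N ≤ n → B.t i n = 0} := Nat.sInf_mem hfin
  have : B.len i ≤ l := Nat.sInf_le fun n hn => by
    rcases hn.eq_or_lt with rfl | hn
    · exact h0
    · exact hmem n (by omega)
  omega

end AlternateBase

/-! ### Asymptotics of the partial remainders of `U_{np-i}`. -/

namespace PositionalSystem

variable (S : PositionalSystem) (B : AlternateBase)

/-- The remainder of `U_{np-i}` after the subtraction of the first `l` digits of `𝐝_i`. -/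
noncomputable def partialDelta (i l n : ℕ) : ℤ :=
  (S.U (n * B.p - i) : ℤ) - ∑ a ∈ Finset.range l, (B.t i a : ℤ) * (S.U (n * B.p - i - a - 1) : ℤ)

theorem partialDelta_zero (i n : ℕ) : S.partialDelta B i 0 n = S.U (n * B.p - i) := by
  simp [partialDelta]

theorem partialDelta_succ (i l n : ℕ) : S.partialDelta B i (l + 1) n =
    S.partialDelta B i l n - B.t i l * S.U (n * B.p - i - l - 1) := by
  rw [partialDelta, partialDelta, Finset.sum_range_succ]; ring

theorem partialDelta_len (i n : ℕ) : S.partialDelta B i (B.len i) n = S.Delta B i n := by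
  have h : Finset.Icc 1 (B.len i) = Finset.Ico 1 (B.len i + 1) := by
    ext a; simp only [Finset.mem_Icc, Finset.mem_Ico]; omega
  rw [Delta, partialDelta, h, Finset.sum_Ico_eq_sum_range]
  simp only [Nat.add_sub_cancel, Nat.sub_sub, add_comm 1, add_assoc]

variable {S B}

/-- Both sides obey the same recursion: multiply by a ratio tending to `β_{i+l}`, then subtract
`t_{i,l}`. -/
theorem HasAssociatedBase.tendsto_partialDelta_div (hB : S.HasAssociatedBase B) (i l : ℕ) :
    Tendsto (fun n => (S.partialDelta B i l n : ℝ) / (S.U (n * B.p - i - l) : ℝ))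
      atTop (𝓝 (B.remainder i 1 l)) := by
  have hU : ∀ n, (S.U n : ℝ) ≠ 0 := fun n => Nat.cast_ne_zero.2 (S.U_pos n).ne'
  induction l with
  | zero =>
    refine tendsto_const_nhds.congr fun n => ?_
    rw [partialDelta_zero, Nat.sub_zero, Int.cast_natCast, div_self (hU _)]
    rfl
  | succ l ih =>
    have h := ((hB.tendsto (i + l)).mul ih).sub_const (B.t i l : ℝ)
    rw [← AlternateBase.remainder_succ] at h
    refine h.congr fun n => ?_
    have h1 := hU (n * B.p - i - l)
    have h2 := hU (n * B.p - i - l - 1)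
    rw [partialDelta_succ, ← Nat.sub_sub _ l 1, ← Nat.sub_sub _ i l]
    push_cast
    field_simp

/-- The limit ratio lies strictly between 0 and 1. The end points are excluded: the ratio is 1 at `l
= 0`, and at `l = ℓ_i` the value is `Δ_i` itself. -/
theorem HasAssociatedBase.eventually_partialDelta (hB : S.HasAssociatedBase B) {i l : ℕ}
    (hl0 : 0 < l) (hl : l < B.len i) (c : ℤ) :
    ∀ᶠ n in atTop, c ≤ S.partialDelta B i l n ∧
      S.partialDelta B i l n < S.U (n * B.p - i - l) := by
  have hU : ∀ n, (0 : ℝ) < S.U n := fun n => Nat.cast_pos.2 (S.U_pos n)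
  have h := hB.tendsto_partialDelta_div i l
  obtain ⟨a, rfl⟩ := Nat.exists_eq_add_of_lt hl0
  simp only [zero_add] at *
  have h1 := h.eventually_lt_const (B.remainder_succ_lt_one i a)
  have h2 := h.pos_mul_atTop (B.remainder_pos hl)
    (S.tendsto_U.comp ((tendsto_sub_atTop_nat (a + 1)).comp (tendsto_mul_sub_atTop B.p_pos i)))
  filter_upwards [h1, h2.eventually_ge_atTop (c : ℝ)] with n h3 h4
  rw [div_lt_one (hU _)] at h3
  simp only [Function.comp_apply] at h4
  rw [div_mul_cancel₀ _ (hU _).ne'] at h4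
  exact ⟨by exact_mod_cast h4, by exact_mod_cast h3⟩

end PositionalSystem

theorem eventually_eq_const_of_periodic {u : ℕ → ℤ} {M : ℕ} (hM : 0 < M)
    (hu : ∀ᶠ n in atTop, u (n + M) = u n) (e : ℕ) : ∃ v, ∀ᶠ q in atTop, u (q * M + e) = v := by
  obtain ⟨N, hN⟩ := eventually_atTop.1 hu
  refine ⟨u (N * M + e), eventually_atTop.2 ⟨N, fun q hq => ?_⟩⟩
  induction q, hq using Nat.le_induction with
  | base => rfl
  | succ q hq ih =>
    rw [← ih, add_mul, one_mul, add_right_comm]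
    exact hN _ ((hq.trans (Nat.le_mul_of_pos_right q hM)).trans (Nat.le_add_right _ _))

theorem tendsto_mul_add_atTop {M : ℕ} (hM : 0 < M) (e : ℕ) :
    Tendsto (fun q : ℕ => q * M + e) atTop atTop :=
  (tendsto_add_atTop_nat e).comp (tendsto_id.atTop_mul_const' hM)

/-! ### Arithmetic of `k` and `m` along the graph, and the quasi-greedy expansion. -/

namespace AlternateBase

variable {B : AlternateBase} {i : ℕ}

theorem k_zero : B.k i 0 = 0 := by simp [k]

theorem k_one : B.k i 1 = B.len i := by simp [k]

theorem k_add (a b : ℕ) : B.k i (a + b) = B.k i a + B.k (B.sigma^[a] i) b := by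
  simp only [k, Finset.sum_range_add]
  simp only [add_comm a, Function.iterate_add_apply]

theorem sigma_lt (hi : i < B.p) (h : ℕ) : B.sigma^[h] i < B.p := by
  cases h with
  | zero => exact hi
  | succ h => rw [Function.iterate_succ_apply']; exact Nat.mod_lt _ B.p_pos

theorem m_zero : B.m i 0 = 0 := by simp [m, k_zero]

theorem m_add (hi : i < B.p) (a b : ℕ) : B.m i (a + b) = B.m i a + B.m (B.sigma^[a] i) b := by
  have h1 := B.m_spec hi (a + b)
  have h2 := B.m_spec hi a
  have h3 := B.m_spec (sigma_lt hi a) b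
  rw [k_add, add_comm a b, Function.iterate_add_apply, add_comm b a] at h1
  refine Nat.eq_of_mul_eq_mul_right B.p_pos ?_
  rw [add_mul]
  omega

/-- Following `h` edges consumes `k_{i,h}` positions. By `m_spec` the same total is subtracted on
both sides, so truncated subtraction does no harm. -/
theorem sub_m_mul (hi : i < B.p) (h n : ℕ) :
    (n - B.m i h) * B.p - B.sigma^[h] i = n * B.p - i - B.k i h := by
  have := B.m_spec hi h
  rw [Nat.sub_mul, Nat.sub_sub, Nat.sub_sub]
  congr 1
  omega

theorem cycleWord_succ (h : ℕ) :
    B.cycleWord i (h + 1) = B.cycleWord i h ++ B.dPrime (B.sigma^[h] i) := by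
  simp [cycleWord, List.range_succ]

theorem length_dPrime : (B.dPrime i).length = B.len i := by simp [dPrime]

theorem length_cycleWord (h : ℕ) : (B.cycleWord i h).length = B.k i h := by
  induction h with
  | zero => simp [cycleWord, k_zero]
  | succ h ih =>
    rw [cycleWord_succ, List.length_append, ih, k_add, k_one, length_dPrime]

theorem quasiGreedy_eq (n : ℕ) (h : ℕ) (hfin : ∀ a < h, B.IsFin (B.sigma^[a] i)) :
    B.quasiGreedy i n = if n < B.k i h then (B.cycleWord i h).getD n 0
      else B.quasiGreedy (B.sigma^[h] i) (n - B.k i h) := by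
  induction h with
  | zero => simp [k_zero]
  | succ h ih =>
    rw [ih fun a ha => hfin a (by omega), k_add, k_one, cycleWord_succ,
      Function.iterate_succ_apply']
    by_cases h1 : n < B.k i h
    · rw [if_pos h1, if_pos (by omega), List.getD_append _ _ _ _ (by rwa [length_cycleWord])]
    · rw [if_neg h1, quasiGreedy, dif_pos (hfin h (by omega))]
      by_cases h2 : n - B.k i h < B.len (B.sigma^[h] i)
      · rw [dif_pos h2, if_pos (by omega),
          List.getD_append_right _ _ _ _ (by rw [length_cycleWord]; omega), length_cycleWord]
      · rw [dif_neg h2, if_neg (by omega), Nat.sub_sub]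

theorem IsCycle.k_pos {r : ℕ} (h : B.IsCycle i r) : 0 < B.k i r := by
  have h1 : B.k i r = B.k i 1 + B.k (B.sigma^[1] i) (r - 1) := by
    rw [← k_add, Nat.add_sub_cancel' h.pos]
  have h2 := len_pos (h.fin 0 h.pos)
  rw [h1, k_one]
  exact Nat.add_pos_left h2 _

theorem IsCycle.quasiGreedy_eq_omegaPower {r : ℕ} (h : B.IsCycle i r) :
    B.quasiGreedy i = omegaPower (B.cycleWord i r) := by
  funext n
  induction n using Nat.strong_induction_on with
  | _ n ih =>
    have hk := h.k_pos
    rw [quasiGreedy_eq n r h.fin, h.closed]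
    split_ifs with hn
    · rw [omegaPower, length_cycleWord, Nat.mod_eq_of_lt hn]
    · rw [ih _ (by omega), omegaPower, omegaPower, length_cycleWord,
        ← Nat.mod_eq_sub_mod (not_lt.1 hn)]

end AlternateBase

/-! ### Sums of `Δ` along a periodic cycle. -/

namespace PositionalSystem

open AlternateBase

/-- The vertex `i` lies on a cycle of length dividing `R` of vertices with finite expansions,
whose sequences `Δ` have the common ultimate period `M`, where `Mp` is the sum of the lengths of
`R` consecutive expansions. -/
structure PeriodicCycle (S : PositionalSystem) (B : AlternateBase) (R M i : ℕ) : Prop where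
  vertex : i < B.p
  pos : 0 < R
  period_pos : 0 < M
  fin : ∀ h, B.IsFin (B.sigma^[h] i)
  periodic : ∀ h, ∀ᶠ n in atTop, S.Delta B (B.sigma^[h] i) (n + M) = S.Delta B (B.sigma^[h] i) n
  closed : B.sigma^[R] i = i
  k_eq : B.k i R = M * B.p

variable {S : PositionalSystem} {B : AlternateBase} {R M i : ℕ}

theorem PeriodicCycle.iterate (H : S.PeriodicCycle B R M i) (a : ℕ) :
    S.PeriodicCycle B R M (B.sigma^[a] i) where
  vertex := sigma_lt H.vertex a
  pos := H.pos
  period_pos := H.period_pos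
  fin h := by rw [← Function.iterate_add_apply]; exact H.fin _
  periodic h := by rw [← Function.iterate_add_apply]; exact H.periodic _
  closed := by
    rw [← Function.iterate_add_apply, add_comm, Function.iterate_add_apply, H.closed]
  k_eq := by
    have h1 := k_add (B := B) (i := i) a R
    have h2 := k_add (B := B) (i := i) R a
    rw [H.closed, add_comm R a] at h2
    have := H.k_eq
    omega

theorem PeriodicCycle.m_eq (H : S.PeriodicCycle B R M i) : B.m i R = M := by
  have h := B.m_spec H.vertex R
  rw [H.closed, H.k_eq] at h
  exact Nat.eq_of_mul_eq_mul_right B.p_pos (by omega)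

theorem DeltaSum_add (hi : i < B.p) (a b n : ℕ) : S.DeltaSum B i (a + b) n =
    S.DeltaSum B i a n + S.DeltaSum B (B.sigma^[a] i) b (n - B.m i a) := by
  simp only [DeltaSum, Finset.sum_range_add]
  congr 1
  refine Finset.sum_congr rfl fun h _ => ?_
  rw [m_add hi, add_comm a h, Function.iterate_add_apply, Nat.sub_sub]

theorem DeltaSum_one (n : ℕ) : S.DeltaSum B i 1 n = S.Delta B i n := by
  simp [DeltaSum, m_zero]

theorem PeriodicCycle.DeltaSum_periodic (H : S.PeriodicCycle B R M i) (h : ℕ) :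
    ∀ᶠ n in atTop, S.DeltaSum B i h (n + M) = S.DeltaSum B i h n := by
  induction h with
  | zero => simp [DeltaSum]
  | succ h ih =>
    filter_upwards [ih, (tendsto_sub_atTop_nat (B.m i h)).eventually (H.periodic h),
      eventually_ge_atTop (B.m i h)] with n h1 h2 h3
    rw [DeltaSum_add H.vertex, DeltaSum_add H.vertex, h1, DeltaSum_one,
      DeltaSum_one, ← h2, Nat.sub_add_comm h3]

theorem PeriodicCycle.exists_DeltaSum_eq (H : S.PeriodicCycle B R M i) (e : ℕ) :
    ∃ δ : ℕ → ℤ, ∀ h, ∀ᶠ q in atTop, S.DeltaSum B i h (q * M + e) = δ h := by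
  choose δ hδ using fun h =>
    eventually_eq_const_of_periodic H.period_pos (H.DeltaSum_periodic h) e
  exact ⟨δ, hδ⟩

theorem PeriodicCycle.DeltaSum_sub_period (H : S.PeriodicCycle B R M i) (h : ℕ) :
    ∀ᶠ n in atTop, S.DeltaSum B i h (n - M) = S.DeltaSum B i h n := by
  filter_upwards [(tendsto_sub_atTop_nat M).eventually (H.DeltaSum_periodic h),
    eventually_ge_atTop M] with n h1 h2
  rw [← h1, Nat.sub_add_cancel h2]

/-- Split the sum over `R + h` steps both as `h` then `R` and as `R` then `h`; by periodicity the
two `h`-step sums cancel. -/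
theorem PeriodicCycle.DeltaSum_shift (H : S.PeriodicCycle B R M i) (h : ℕ) :
    ∀ᶠ n in atTop, S.DeltaSum B (B.sigma^[h] i) R (n - B.m i h) = S.DeltaSum B i R n := by
  filter_upwards [H.DeltaSum_sub_period h] with n h1
  have h2 := DeltaSum_add (S := S) H.vertex h R n
  have h3 := DeltaSum_add (S := S) H.vertex R h n
  rw [H.closed, H.m_eq, h1, add_comm R h] at h3
  linarith

theorem PeriodicCycle.eventually_nonneg_iterate (H : S.PeriodicCycle B R M i)
    (h0 : ∀ᶠ n in atTop, 0 ≤ S.DeltaSum B i R n) (h : ℕ) :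
    ∀ᶠ n in atTop, 0 ≤ S.DeltaSum B (B.sigma^[h] i) R n := by
  have h1 : ∀ᶠ n in atTop, 0 ≤ S.DeltaSum B (B.sigma^[h] i) R (n - B.m i h) := by
    filter_upwards [h0, H.DeltaSum_shift h] with n h2 h3
    rwa [h3]
  filter_upwards [(tendsto_add_atTop_nat (B.m i h)).eventually h1] with n h2
  rwa [Nat.add_sub_cancel] at h2

theorem greedyWord_toNat_eq_append (S : PositionalSystem) (t : ℕ → ℕ) (A : ℕ → ℤ) {N m : ℕ}
    (hm : m ≤ N) (h0 : ∀ l < m, A l = t l * S.U (N - l - 1) + A (l + 1))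
    (h1 : ∀ l < m, 0 ≤ A (l + 1) ∧ A (l + 1) < S.U (N - l - 1)) :
    S.greedyWord N (A 0).toNat = (List.range m).map t ++ S.greedyWord (N - m) (A m).toNat := by
  refine S.greedyWord_eq_append t (fun l => (A l).toNat) N m hm fun l hl => ?_
  obtain ⟨h2, h3⟩ := h1 l hl
  constructor
  · zify
    rw [Int.toNat_of_nonneg h2, Int.toNat_of_nonneg, h0 l hl]
    rw [h0 l hl]
    positivity
  · omega

/-- One edge of the graph. The comparison of `d` with `c` decides whether the last digit of `𝐝_i`
must be lowered to keep the remainder nonnegative. -/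
theorem padWord_eq (hB : S.HasAssociatedBase B) (hi : i < B.p) (hfin : B.IsFin i)
    {c : ℤ} (hc : 1 ≤ c) (d : ℤ) :
    ∀ᶠ n in atTop, S.Delta B i n = d →
      (d < c → S.padWord B.p i c n =
        B.dPrime i ++ S.padWord B.p (B.sigma i) (c - d) (n - B.m i 1)) ∧
      (c ≤ d → S.padWord B.p i c n = (List.range (B.len i)).map (B.t i) ++
        S.greedyWord ((n - B.m i 1) * B.p - B.sigma i) (d - c).toNat) := by
  have hlen := len_pos hfin
  have hpart : ∀ᶠ n in atTop, ∀ l ∈ Finset.Ioo 0 (B.len i), c ≤ S.partialDelta B i l n ∧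
      S.partialDelta B i l n < S.U (n * B.p - i - l) := by
    rw [Filter.eventually_all_finset]
    intro l hl
    rw [Finset.mem_Ioo] at hl
    exact hB.eventually_partialDelta hl.1 hl.2 c
  have hNt := tendsto_mul_sub_atTop B.p_pos i
  have hUt := S.strictMono.tendsto_atTop.comp ((tendsto_sub_atTop_nat (B.len i)).comp hNt)
  filter_upwards [hpart, hNt.eventually_ge_atTop (B.len i),
    hUt.eventually_gt_atTop (c - d).toNat, hUt.eventually_gt_atTop (d - c).toNat]
    with n hn hN hU1 hU2 hd
  simp only [Function.comp_apply] at hU1 hU2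
  have hsub : (n - B.m i 1) * B.p - B.sigma i = n * B.p - i - B.len i := by
    rw [← k_one]; exact sub_m_mul hi 1 n
  have hzero := S.partialDelta_zero B i n
  have hlast : S.partialDelta B i (B.len i) n = d := by rw [partialDelta_len, hd]
  have hsucc := S.partialDelta_succ B i (n := n)
  rw [padWord, padWord, hsub]
  generalize n * B.p - i = N at *
  generalize hL : B.len i = L at *
  constructor
  · intro hdc
    -- Lowering the last digit returns one `U_{N-L}` to the final remainder, which becomes `U_{N-L}
    -- - (c - d)`.
    have key := S.greedyWord_toNat_eq_append (fun a => if a + 1 = L then B.t i a - 1 else B.t i a)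
      (fun l => S.partialDelta B i l n - c + if l = L then (S.U (N - L) : ℤ) else 0) hN ?_ ?_
    · simp only [if_true, if_neg hlen.ne, hzero, hlast, add_zero] at key
      rw [key, dPrime, hL]
      congr 3
      ring
    · intro l hl
      simp only [hsucc, if_neg hl.ne]
      by_cases h : l + 1 = L
      -- The last digit is positive, so the natural subtraction of 1 is genuine.
      · have ht := B.t_last_pos (h.trans hL.symm)
        have hN' : N - l - 1 = N - L := by omega
        rw [if_pos h, if_pos h, hN']
        push_cast [Nat.succ_le_of_lt ht]
        ring
      · rw [if_neg h, if_neg h]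
        ring
    · intro l hl
      have hN' : N - l - 1 = N - (l + 1) := by omega
      rw [hN']
      by_cases h : l + 1 = L
      · simp only [h, if_true, hlast]
        omega
      · simp only [if_neg h]
        have := hn (l + 1) (Finset.mem_Ioo.2 ⟨by omega, by omega⟩)
        omega
  · intro hcd
    have key := S.greedyWord_toNat_eq_append (B.t i) (fun l => S.partialDelta B i l n - c) hN ?_ ?_
    · simpa only [hzero, hlast] using key
    · intro l _
      simp only [hsucc]
      ring
    · intro l hl
      have hN' : N - l - 1 = N - (l + 1) := by omega
      rw [hN']
      by_cases h : l + 1 = L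
      · simp only [h, hlast]
        omega
      · have := hn (l + 1) (Finset.mem_Ioo.2 ⟨by omega, by omega⟩)
        omega

end PositionalSystem

/-! ### Iterating around the cycle: regularity when the total is nonnegative. -/

namespace PositionalSystem

open AlternateBase

variable {S : PositionalSystem} {B : AlternateBase} {R M i e : ℕ}

theorem tendsto_mul_add_sub_atTop (hM : 0 < M) (e m : ℕ) :
    Tendsto (fun q : ℕ => q * M + e - m) atTop atTop :=
  (tendsto_sub_atTop_nat m).comp (tendsto_mul_add_atTop hM e)

theorem PeriodicCycle.eventually_Delta_eq (H : S.PeriodicCycle B R M i) {δ : ℕ → ℤ}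
    (hδ : ∀ h, ∀ᶠ q in atTop, S.DeltaSum B i h (q * M + e) = δ h) (h : ℕ) :
    ∀ᶠ q in atTop, S.Delta B (B.sigma^[h] i) (q * M + e - B.m i h) = δ (h + 1) - δ h := by
  filter_upwards [hδ h, hδ (h + 1)] with q h1 h2
  rw [DeltaSum_add H.vertex, DeltaSum_one] at h2
  linarith

theorem PeriodicCycle.padWord_eq_cycleWord_append (hB : S.HasAssociatedBase B)
    (H : S.PeriodicCycle B R M i) {δ : ℕ → ℤ}
    (hδ : ∀ h, ∀ᶠ q in atTop, S.DeltaSum B i h (q * M + e) = δ h) {c : ℤ} {h : ℕ}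
    (hc : ∀ a ≤ h, δ a < c) :
    ∀ᶠ q in atTop, S.padWord B.p i c (q * M + e) = B.cycleWord i h ++
      S.padWord B.p (B.sigma^[h] i) (c - δ h) (q * M + e - B.m i h) := by
  induction h with
  | zero =>
    filter_upwards [hδ 0] with q h0
    have : δ 0 = 0 := by rw [← h0]; simp [DeltaSum]
    simp [cycleWord, this, m_zero]
  | succ h ih =>
    have h1 := hc h (by omega)
    have h2 := hc (h + 1) le_rfl
    have h3 := padWord_eq hB (H.iterate h).vertex (H.fin h) (c := c - δ h) (by omega)
      (δ (h + 1) - δ h)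
    filter_upwards [ih fun a ha => hc a (by omega), H.eventually_Delta_eq hδ h,
      (tendsto_mul_add_sub_atTop H.period_pos e (B.m i h)).eventually h3] with q h4 h5 h6
    rw [h4, (h6 h5).1 (by omega), cycleWord_succ, List.append_assoc, m_add H.vertex,
      Function.iterate_succ_apply', Nat.sub_sub, sub_sub_sub_cancel_right]

theorem PeriodicCycle.padWord_eq_cycleWord_append_self (hB : S.HasAssociatedBase B)
    (H : S.PeriodicCycle B R M i) {δ : ℕ → ℤ}
    (hδ : ∀ h, ∀ᶠ q in atTop, S.DeltaSum B i h (q * M + e) = δ h) {c : ℤ}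
    (hc : ∀ a ≤ R, δ a < c) :
    ∀ᶠ q in atTop, S.padWord B.p i c ((q + 1) * M + e) = B.cycleWord i R ++
      S.padWord B.p i (c - δ R) (q * M + e) := by
  have h := H.padWord_eq_cycleWord_append hB hδ hc
  rw [H.closed, H.m_eq] at h
  filter_upwards [(tendsto_add_atTop_nat 1).eventually h] with q hq
  rw [hq]
  congr 2
  rw [add_mul, one_mul, add_right_comm, Nat.add_sub_cancel]

/-- For a fixed `x`, raising `q` by one eventually just prepends `Mp` zeros. -/
theorem PeriodicCycle.isRegular_range_greedyWord (H : S.PeriodicCycle B R M i) (m s x : ℕ) :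
    Language.IsRegular
      ((Set.range fun q => S.greedyWord ((q * M + e - m) * B.p - s) x : Set (List ℕ)) :
        Language ℕ) := by
  refine Language.isRegular_range_of_eventually_append (List.replicate (M * B.p) 0) ?_
  have h1 := tendsto_mul_add_sub_atTop H.period_pos e m
  have h2 := (tendsto_mul_sub_atTop B.p_pos s).comp h1
  filter_upwards [h1.eventually_ge_atTop 1, h2.eventually_ge_atTop 1,
    (S.strictMono.tendsto_atTop.comp h2).eventually_gt_atTop x] with q h3 h4 h5
  simp only [Function.comp_apply] at h4 h5
  rw [← S.greedyWord_add h5]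
  congr 1
  have h6 : (q + 1) * M + e - m = M + (q * M + e - m) := by
    rw [add_mul, one_mul]; omega
  rw [h6, add_mul]
  omega

theorem PeriodicCycle.isRegular_range_padWord (hB : S.HasAssociatedBase B)
    (H : S.PeriodicCycle B R M i) {δ : ℕ → ℤ}
    (hδ : ∀ h, ∀ᶠ q in atTop, S.DeltaSum B i h (q * M + e) = δ h) (hR : 0 ≤ δ R) (c : ℤ)
    (hc : 1 ≤ c) :
    Language.IsRegular
      ((Set.range fun q => S.padWord B.p i c (q * M + e) : Set (List ℕ)) : Language ℕ) := by
  have h0 : δ 0 = 0 := by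
    obtain ⟨q, hq⟩ := (hδ 0).exists
    rw [← hq]; simp [DeltaSum]
  induction hn : c.toNat using Nat.strong_induction_on generalizing c with
  | _ n ih =>
  by_cases hex : ∃ a ≤ R, c ≤ δ a
  · classical
    obtain ⟨ha, hca⟩ := Nat.find_spec hex
    -- The first index with `c ≤ δ` is not 0, since `δ 0 = 0 < c`; the algorithm leaves the cycle on
    -- the edge from `a` to `a + 1`.
    obtain ⟨a, hfa⟩ : ∃ a, Nat.find hex = a + 1 := Nat.exists_eq_succ_of_ne_zero fun h => by
      rw [h, h0] at hca; omega
    have hlt : ∀ b ≤ a, δ b < c := by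
      intro b hb
      have := Nat.find_min hex (m := b) (by omega)
      push Not at this
      exact this (by omega)
    rw [hfa] at hca
    have h3 := padWord_eq hB (H.iterate a).vertex (H.fin a) (c := c - δ a)
      (by have := hlt a le_rfl; omega) (δ (a + 1) - δ a)
    have h4 := H.padWord_eq_cycleWord_append hB hδ hlt
    refine Language.isRegular_range_of_eventually_eq_append
      (B.cycleWord i a ++ (List.range (B.len (B.sigma^[a] i))).map (B.t (B.sigma^[a] i)))
      (H.isRegular_range_greedyWord (e := M + e) (B.m i (a + 1)) (B.sigma^[a + 1] i)
        (δ (a + 1) - c).toNat) ?_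
    filter_upwards [(tendsto_add_atTop_nat 1).eventually h4,
      (tendsto_add_atTop_nat 1).eventually (H.eventually_Delta_eq hδ a),
      (tendsto_add_atTop_nat 1).eventually
        ((tendsto_mul_add_sub_atTop H.period_pos e (B.m i a)).eventually h3)] with q h5 h6 h7
    have h8 : q * M + (M + e) = (q + 1) * M + e := by ring
    rw [h5, (h7 h6).2 (by omega), m_add H.vertex, h8, List.append_assoc,
      Function.iterate_succ_apply', Nat.sub_sub, sub_sub_sub_cancel_right]
  · push Not at hex
    have h1 := H.padWord_eq_cycleWord_append_self hB hδ hex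
    -- A full turn is completed: either `c` is unchanged and the cycle word repeats, or `c - δ R` is
    -- smaller and still positive, so induction applies.
    rcases hR.eq_or_lt with h | h
    · rw [← h, sub_zero] at h1
      exact Language.isRegular_range_of_eventually_append _ h1
    · refine Language.isRegular_range_of_eventually_eq_append _ (ih _ ?_ (c - δ R) ?_ rfl) h1 <;>
      · have := hex R le_rfl
        omega

theorem PeriodicCycle.isRegular_langC (hB : S.HasAssociatedBase B)
    (H : S.PeriodicCycle B R M i) (h0 : ∀ᶠ n in atTop, 0 ≤ S.DeltaSum B i R n) {c : ℕ}
    (hc : 1 ≤ c) : (S.langC B.p i c).IsRegular := by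
  have h1 : Language.IsRegular
      ((Set.range fun n => S.padWord B.p i c n : Set (List ℕ)) : Language ℕ) := by
    refine Language.isRegular_range_of_residues H.period_pos fun e _ => ?_
    obtain ⟨δ, hδ⟩ := H.exists_DeltaSum_eq e
    refine H.isRegular_range_padWord hB hδ ?_ c (by exact_mod_cast hc)
    obtain ⟨q, h2, h3⟩ :=
      ((hδ R).and ((tendsto_mul_add_atTop H.period_pos e).eventually h0)).exists
    rwa [← h2]
  have h2 := h1.of_eventually (P := fun n => 1 ≤ n ∧ c ≤ S.U (n * B.p - i))
    (g := S.repPad B.p i c) ?_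
  · refine Eq.mpr (congrArg Language.IsRegular ?_) h2
    ext w
    exact exists_congr fun n => and_assoc.symm
  · filter_upwards [eventually_ge_atTop 1, (S.strictMono.tendsto_atTop.comp
      (tendsto_mul_sub_atTop B.p_pos i)).eventually_ge_atTop c] with n h3 h4
    refine ⟨⟨h3, h4⟩, ?_⟩
    rw [S.repPad_eq_greedyWord _ _ _ _ hc, padWord]
    congr 1
    omega

/-! ### Non-regularity when the total is negative. -/

theorem PeriodicCycle.padWord_eq_replicate_append (hB : S.HasAssociatedBase B)
    (H : S.PeriodicCycle B R M i) {δ : ℕ → ℤ}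
    (hδ : ∀ h, ∀ᶠ q in atTop, S.DeltaSum B i h (q * M + e) = δ h) (hneg : ∀ a ≤ R, δ a ≤ 0)
    (a : ℕ) {c : ℤ} (hc : 1 ≤ c) :
    ∀ᶠ q in atTop, S.padWord B.p i c ((q + a) * M + e) =
      (List.replicate a (B.cycleWord i R)).flatten ++
        S.padWord B.p i (c - a * δ R) (q * M + e) := by
  induction a generalizing c with
  | zero => simp
  | succ a ih =>
    have h1 := H.padWord_eq_cycleWord_append_self hB hδ (c := c)
      fun b hb => (hneg b hb).trans_lt (by omega)
    have hR := hneg R le_rfl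
    filter_upwards [(tendsto_add_atTop_nat a).eventually h1, ih (c := c - δ R) (by omega)]
      with q h2 h3
    rw [← add_assoc, h2, h3, List.replicate_succ, List.flatten_cons, List.append_assoc]
    push_cast
    congr 3
    ring

theorem PeriodicCycle.not_isRegular_lang (hB : S.HasAssociatedBase B)
    (H : S.PeriodicCycle B R M i) {δ : ℕ → ℤ}
    (hδ : ∀ h, ∀ᶠ q in atTop, S.DeltaSum B i h (q * M + e) = δ h) (hneg : ∀ a ≤ R, δ a ≤ 0)
    (hR : δ R < 0) : ¬ (S.lang B.p i).IsRegular := by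
  intro hreg
  set L := S.lang B.p i
  have hmem : ∀ w, w ∈ L ↔ ∃ n, 1 ≤ n ∧ w = S.padWord B.p i 1 n := by
    intro w
    refine exists_congr fun n => and_congr_right fun _ => ?_
    rw [rep_U_sub_one, padWord]
    have : ((S.U (n * B.p - i) : ℤ) - 1).toNat = S.U (n * B.p - i) - 1 := by omega
    rw [this]
  have hfin := hreg.finite_range_leftQuotient
  -- Finitely many quotients: two distinct powers of the cycle word accept the same continuations.
  obtain ⟨a, b, hab, heq⟩ : ∃ a b : ℕ, a ≠ b ∧
      L.leftQuotient (List.replicate a (B.cycleWord i R)).flatten =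
        L.leftQuotient (List.replicate b (B.cycleWord i R)).flatten := by
    have hninj : ¬ Function.Injective fun a : ℕ =>
        L.leftQuotient (List.replicate a (B.cycleWord i R)).flatten := fun hinj =>
      Set.infinite_range_of_injective hinj (hfin.subset (by rintro _ ⟨a, rfl⟩; exact ⟨_, rfl⟩))
    simp only [Function.Injective, not_forall] at hninj
    obtain ⟨a, b, h1, h2⟩ := hninj
    exact ⟨a, b, h2, h1⟩
  have hUt := (S.strictMono.tendsto_atTop.comp (tendsto_mul_sub_atTop B.p_pos i)).comp
    (tendsto_mul_add_atTop H.period_pos e)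
  obtain ⟨q, h1, h2, h3, h4, h5, h6⟩ :=
    ((H.padWord_eq_replicate_append hB hδ hneg a le_rfl).and <|
      (H.padWord_eq_replicate_append hB hδ hneg b le_rfl).and <|
      (hUt.eventually_gt_atTop (1 - a * δ R).toNat).and <|
      (hUt.eventually_gt_atTop (1 - b * δ R).toNat).and <|
      (eventually_ge_atTop 1).and <|
      (tendsto_mul_sub_atTop B.p_pos i).comp
        (tendsto_mul_add_atTop H.period_pos e) |>.eventually_ge_atTop 1).exists
  simp only [Function.comp_apply] at h3 h4 h6
  have hq : 1 ≤ q * M := Nat.mul_pos h5 H.period_pos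
  have h7 : (List.replicate a (B.cycleWord i R)).flatten ++
      S.padWord B.p i (1 - a * δ R) (q * M + e) ∈ L :=
    (hmem _).2 ⟨(q + a) * M + e, by rw [add_mul]; omega, h1.symm⟩
  have h8 : (List.replicate b (B.cycleWord i R)).flatten ++
      S.padWord B.p i (1 - a * δ R) (q * M + e) ∈ L := by
    change _ ∈ L.leftQuotient _
    rw [← heq]
    exact h7
  obtain ⟨n, _, hn⟩ := (hmem _).1 h8
  have hlen := congrArg List.length hn
  have hlen2 := congrArg List.length h2
  simp only [List.length_append, padWord, length_greedyWord] at hlen hlen2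
  rw [← hlen2] at hlen
  -- The word's length fixes `n`, positivity of the length ruling out truncation. Injectivity of
  -- greedy words then forces `a * δ R = b * δ R`.
  have hn' : n = (q + b) * M + e := by
    refine Nat.eq_of_mul_eq_mul_right B.p_pos ?_
    have : i < ((q + b) * M + e) * B.p := by omega
    omega
  rw [hn', h2] at hn
  have h9 := S.greedyWord_injOn _ ?_ ?_ (List.append_cancel_left hn)
  · have ha : 0 ≤ -((a : ℤ) * δ R) := by nlinarith
    have hb : 0 ≤ -((b : ℤ) * δ R) := by nlinarith
    have h10 : (a : ℤ) * δ R = b * δ R := by omega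
    exact hab (by exact_mod_cast mul_right_cancel₀ hR.ne h10)
  · have ha : 0 ≤ -((a : ℤ) * δ R) := by nlinarith
    have := S.U_pos ((q * M + e) * B.p - i)
    omega
  · have hb : 0 ≤ -((b : ℤ) * δ R) := by nlinarith
    have := S.U_pos ((q * M + e) * B.p - i)
    omega

theorem PeriodicCycle.exists_not_isRegular_lang (hB : S.HasAssociatedBase B)
    (H : S.PeriodicCycle B R M i) {δ : ℕ → ℤ}
    (hδ : ∀ h, ∀ᶠ q in atTop, S.DeltaSum B i h (q * M + e) = δ h) (hR : δ R < 0) :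
    ∃ a, ¬ (S.lang B.p (B.sigma^[a] i)).IsRegular := by
  -- Rotate to a maximum of `δ` over one turn; as later turns only add the negative `δ R`, all
  -- partial sums from there are nonpositive.
  obtain ⟨a, ha, hmax⟩ := Finset.exists_max_image (Finset.range R) δ
    ⟨0, Finset.mem_range.2 H.pos⟩
  rw [Finset.mem_range] at ha
  simp only [Finset.mem_range] at hmax
  have hadd : ∀ h, δ (R + h) = δ R + δ h := by
    intro h
    obtain ⟨q, h1, h2, h3, h4⟩ := ((hδ (R + h)).and <| (hδ R).and <| (hδ h).and <|
      (tendsto_mul_add_atTop H.period_pos e).eventually (H.DeltaSum_sub_period h)).exists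
    rw [← h1, ← h2, ← h3, DeltaSum_add H.vertex, H.closed, H.m_eq, h4]
  -- The residue at the new vertex is `e - m_{i,a}`; adding `m_{i,a} * M` keeps it a natural number.
  refine ⟨a, (H.iterate a).not_isRegular_lang hB (e := B.m i a * M + e - B.m i a)
    (δ := fun h => δ (a + h) - δ a) ?_ ?_ ?_⟩
  · intro h
    filter_upwards [(tendsto_add_atTop_nat (B.m i a)).eventually (hδ a),
      (tendsto_add_atTop_nat (B.m i a)).eventually (hδ (a + h))] with q h1 h2
    have h3 : B.m i a ≤ B.m i a * M := Nat.le_mul_of_pos_right _ H.period_pos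
    have h4 : q * M + (B.m i a * M + e - B.m i a) = (q + B.m i a) * M + e - B.m i a := by
      rw [add_mul]; omega
    rw [DeltaSum_add H.vertex] at h2
    rw [h4, ← h2, ← h1]
    ring
  · intro h hh
    rcases lt_or_ge (a + h) R with h1 | h1
    · have := hmax _ h1
      omega
    · obtain ⟨b, hb⟩ := Nat.exists_eq_add_of_le h1
      have h2 := hmax b (by omega)
      simp only [hb, hadd]
      omega
  · simp only [add_comm a R, hadd]
    omega

/-! ### Reduction to finitely many constants, and the equivalence. -/

theorem PeriodicCycle.DeltaConst_eq (H : S.PeriodicCycle B R M i) (e h : ℕ) :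
    ∀ᶠ q in atTop, S.DeltaSum B i h (q * M + e) = S.DeltaConst B M i h e := by
  obtain ⟨δ, hδ⟩ := H.exists_DeltaSum_eq e
  rw [DeltaConst, ultimateValue_eq (hδ h)]
  exact hδ h

theorem PeriodicCycle.DeltaConst_nonneg (H : S.PeriodicCycle B R M i)
    (h0 : ∀ᶠ n in atTop, 0 ≤ S.DeltaSum B i R n) (e : ℕ) : 0 ≤ S.DeltaConst B M i R e := by
  obtain ⟨q, h1, h2⟩ := ((H.DeltaConst_eq e R).and
    ((tendsto_mul_add_atTop H.period_pos e).eventually h0)).exists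
  rwa [← h1]

/-- Since `σ^r(i) = i`, shift invariance with `h = r` makes the full-turn sum ultimately
`m_{i,r}`-periodic, so residues below `m_{i,r}` suffice. -/
theorem PeriodicCycle.eventually_nonneg_of_DeltaConst (H : S.PeriodicCycle B R M i) {r M' : ℕ}
    (hr : B.sigma^[r] i = i) (hM' : M = M' * B.m i r)
    (h0 : ∀ e < B.m i r, 0 ≤ S.DeltaConst B M i R e) :
    ∀ᶠ n in atTop, 0 ≤ S.DeltaSum B i R n := by
  have hpos : 0 < M' * B.m i r := hM' ▸ H.period_pos
  have hm : 0 < B.m i r := Nat.pos_of_mul_pos_left hpos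
  have hM0 : 0 < M' := Nat.pos_of_mul_pos_right hpos
  have hshift : ∀ᶠ n in atTop, S.DeltaSum B i R (n + B.m i r) = S.DeltaSum B i R n := by
    have h1 := H.DeltaSum_shift r
    rw [hr] at h1
    filter_upwards [(tendsto_add_atTop_nat (B.m i r)).eventually h1] with n h2
    rw [← h2, Nat.add_sub_cancel]
  obtain ⟨N, hN⟩ := eventually_atTop.1 hshift
  have hN' : ∀ a n, N ≤ n → S.DeltaSum B i R (n + a * B.m i r) = S.DeltaSum B i R n := by
    intro a
    induction a with
    | zero => simp
    | succ a ih =>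
      intro n hn
      rw [add_mul, one_mul, ← add_assoc, hN _ (by omega), ih n hn]
  filter_upwards [eventually_ge_atTop N] with n hn
  obtain ⟨q, h1, h2⟩ := ((H.DeltaConst_eq (n % B.m i r) R).and
    (eventually_ge_atTop (n / B.m i r))).exists
  have h3 : n / B.m i r ≤ q * M' := h2.trans (Nat.le_mul_of_pos_right q hM0)
  have h4 : q * M + n % B.m i r = n + (q * M' - n / B.m i r) * B.m i r := by
    have h5 := Nat.div_add_mod' n (B.m i r)
    have h6 := Nat.mul_le_mul_right (B.m i r) h3
    rw [Nat.sub_mul, hM', ← mul_assoc]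
    omega
  rw [h4, hN' _ n hn] at h1
  rw [h1]
  exact h0 _ (Nat.mod_lt _ hm)

theorem IsCycle.periodicCycle {r M' : ℕ} (hcycle : B.IsCycle i r)
    (hper : ∀ h < r, UltimatelyPeriodic (S.Delta B (B.sigma^[h] i)) M)
    (hM' : 1 ≤ M') (hM : M * B.p = M' * B.k i r) : S.PeriodicCycle B (M' * r) M i := by
  have hmod : ∀ h, B.sigma^[h % r] i = B.sigma^[h] i := fun h =>
    Function.IsPeriodicPt.iterate_mod_apply hcycle.closed h
  have hlt : ∀ h, h % r < r := fun h => Nat.mod_lt h hcycle.pos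
  refine ⟨hcycle.vertex, Nat.mul_pos hM' hcycle.pos, (hper 0 hcycle.pos).1,
    fun h => hmod h ▸ hcycle.fin _ (hlt h),
    fun h => hmod h ▸ eventually_atTop.2 (hper _ (hlt h)).2, ?_, ?_⟩
  · rw [← hmod, Nat.mul_mod_left]; rfl
  · have hk : ∀ a, B.k i (a * r) = a * B.k i r := by
      intro a
      induction a with
      | zero => simp [k_zero]
      | succ a ih =>
        rw [add_mul, one_mul, k_add, ih, ← hmod, Nat.mul_mod_left, add_mul, one_mul]
        rfl
    rw [hk, hM]

end PositionalSystem

theorem mainTheorem3 (S : PositionalSystem) (B : AlternateBase) (hB : S.HasAssociatedBase B)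
    (i r : ℕ) (hcycle : B.IsCycle i r) (M M' : ℕ)
    (hper : ∀ h < r, UltimatelyPeriodic (S.Delta B (B.sigma^[h] i)) M)
    (hM' : 1 ≤ M') (hM : M * B.p = M' * B.k i r) :
    B.quasiGreedy i = omegaPower (B.cycleWord i r) ∧
    List.TFAE [
      ∀ h < r, (S.lang B.p (B.sigma^[h] i)).IsRegular,
      ∀ c, 1 ≤ c → ∀ h < r, (S.langC B.p (B.sigma^[h] i) c).IsRegular,
      ∀ e < B.k i r / B.p, ∀ j < r, 0 ≤ S.DeltaConst B M (B.sigma^[j] i) (M' * r) e,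
      ∀ e < B.k i r / B.p, 0 ≤ S.DeltaConst B M i (M' * r) e] := by
  refine ⟨hcycle.quasiGreedy_eq_omegaPower, ?_⟩
  have H := PositionalSystem.IsCycle.periodicCycle hcycle hper hM' hM
  have hk : B.k i r = B.m i r * B.p := by
    have h := B.m_spec hcycle.vertex r
    rw [hcycle.closed] at h
    omega
  have hdiv : B.k i r / B.p = B.m i r := by rw [hk, Nat.mul_div_cancel _ B.p_pos]
  have hMm : M = M' * B.m i r := Nat.eq_of_mul_eq_mul_right B.p_pos (by rw [hM, hk, mul_assoc])
  rw [hdiv]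
  have hnonneg := H.eventually_nonneg_of_DeltaConst hcycle.closed hMm
  tfae_have 2 → 1 := fun h a ha => by
    rw [← S.langC_one]
    exact h 1 le_rfl a ha
  tfae_have 1 → 4 := by
    intro h e _
    by_contra hneg
    obtain ⟨a, ha⟩ := H.exists_not_isRegular_lang hB (fun h => H.DeltaConst_eq e h)
      (not_le.1 hneg)
    -- The vertex found may lie beyond the first turn, so its index is reduced mod `r`.
    rw [← Function.IsPeriodicPt.iterate_mod_apply hcycle.closed a] at ha
    exact ha (h _ (Nat.mod_lt a hcycle.pos))
  tfae_have 4 → 3 := fun h e _ j _ =>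
    (H.iterate j).DeltaConst_nonneg (H.eventually_nonneg_iterate (hnonneg h) j) e
  tfae_have 3 → 4 := fun h e he => h e he 0 hcycle.pos
  tfae_have 4 → 2 := fun h c hc a _ =>
    (H.iterate a).isRegular_langC hB (H.eventually_nonneg_iterate (hnonneg h) a) hc
  tfae_finish
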